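/- **Theorem.** Formulas are built from a countably infinite set of variables with $\land,\lor,\to,\leftarrow,\top,\bot$; write $\neg\varphi:=\varphi\to\bot$ and ${\sim}\varphi:=\top\leftarrow\varphi$. A *super-bi-intuitionistic logic* is a set of formulas that contains the bi-intuitionistic propositional calculus $\mathsf{bi\text{-}IPC}$ and is closed under modus ponens, uniform substitution and the rule "from $\varphi$ infer $\neg{\sim}\varphi$"; for such a logic $L$ and a set $\Sigma$ of formulas, $L+\Sigma$ is the least super-bi-intuitionistic logic containing $L\cup\Sigma$. Let $\mathsf{bi\text{-}LC}:=\mathsf{bi\text{-}IPC}+(p\to q)\lor(q\to p)$. A *bi-Gödel algebra* is a bi-Heyting algebra that validates $(p\to q)\lor(q\to p)$. For a finite subdirectly irreducible bi-Gödel algebra $A$ and a set $D\subseteq A^2$, take distinct variables $p_a$ ($a\in A$), and let $\Gamma$ be the conjunction of the formulas $p_{a\lor b}\leftrightarrow(p_a\lor p_b)$, $p_{a\land b}\leftrightarrow(p_a\land p_b)$ and $p_{a\to b}\leftrightarrow(p_a\to p_b)$ for all $(a,b)\in A^2$, the formulas $p_{a\leftarrow b}\leftrightarrow(p_a\leftarrow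 p_b)$ for all $(a,b)\in D$, and $p_0\leftrightarrow\bot$, $p_1\leftrightarrow\top$. The *stable canonical formula* of $A$ and $D$ is $$\gamma(A,D):=\neg{\sim}\Gamma\to\neg\bigwedge\{p_a\leftarrow p_b : a,b\in A,\ a\nleq b\}.$$ Let $L$ be a super-bi-intuitionistic logic that contains $\mathsf{bi\text{-}LC}$. Then there is a set $\Sigma$ of stable canonical formulas such that $L=\mathsf{bi\text{-}LC}+\Sigma$. Moreover, if $L=\mathsf{bi\text{-}LC}+F$ for some finite set $F$ of formulas, then $L=\mathsf{bi\text{-}LC}+\Sigma$ for some finite set $\Sigma$ of stable canonical formulas. -/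

import Mathlib

namespace BiInt

/-- Formulas in the language `∧, ∨, →, ←, ⊤, ⊥`, over the denumerable set `ℕ` of variables. -/
inductive Formula : Type
  | var : ℕ → Formula
  | bot : Formula
  | top : Formula
  | and : Formula → Formula → Formula
  | or : Formula → Formula → Formula
  | imp : Formula → Formula → Formula
  | coimp : Formula → Formula → Formula

namespace Formula

/-- `¬ φ := φ → ⊥`. -/
def neg (φ : Formula) : Formula := imp φ bot

/-- `∼ φ := ⊤ ← φ`. -/
def coneg (φ : Formula) : Formula := coimp top φ

/-- `φ ↔ ψ`. -/
def iff (φ ψ : Formula) : Formula := and (imp φ ψ) (imp ψ φ)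

/-- Conjunction of a list of formulas, with `⊤` as the empty conjunction. -/
def conj (l : List Formula) : Formula := l.foldr and top

/-- Uniform substitution. -/
def subst (σ : ℕ → Formula) : Formula → Formula
  | var n => σ n
  | bot => bot
  | top => top
  | and φ ψ => and (subst σ φ) (subst σ ψ)
  | or φ ψ => or (subst σ φ) (subst σ ψ)
  | imp φ ψ => imp (subst σ φ) (subst σ ψ)
  | coimp φ ψ => coimp (subst σ φ) (subst σ ψ)

/-- Formulas of the intuitionistic language, i.e. without co-implication. -/
def CoimpFree : Formula → Prop
  | var _ => True
  | bot => True
  | top => True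
  | and φ ψ => CoimpFree φ ∧ CoimpFree ψ
  | or φ ψ => CoimpFree φ ∧ CoimpFree ψ
  | imp φ ψ => CoimpFree φ ∧ CoimpFree ψ
  | coimp _ _ => False

/-- The extension of a valuation `v` in a bi-Heyting algebra to all formulas. In Mathlib `a ⇨ b` is
the implication `a → b`, and `a \ b` is the co-implication `a ← b`. -/
def eval {A : Type*} [BiheytingAlgebra A] (v : ℕ → A) : Formula → A
  | var n => v n
  | bot => ⊥
  | top => ⊤
  | and φ ψ => eval v φ ⊓ eval v ψ
  | or φ ψ => eval v φ ⊔ eval v ψ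
  | imp φ ψ => eval v φ ⇨ eval v ψ
  | coimp φ ψ => eval v φ \ eval v ψ

end Formula

open Formula

/-! ### Logics -/

/-- Standard Hilbert-style axioms of intuitionistic propositional logic,
in the variables `p = var 0`, `q = var 1`, `r = var 2`. -/
def ipcAxioms : Set Formula :=
  let p := var 0
  let q := var 1
  let r := var 2
  { imp p (imp q p),
    imp (imp p (imp q r)) (imp (imp p q) (imp p r)),
    imp (and p q) p,
    imp (and p q) q,
    imp p (imp q (and p q)),
    imp p (or p q),
    imp q (or p q),
    imp (imp p r) (imp (imp q r) (imp (or p q) r)),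
    imp bot p,
    top }

/-- The intuitionistic propositional calculus, a set of formulas without co-implication. -/
inductive IPC : Formula → Prop
  | ax {φ : Formula} : φ ∈ ipcAxioms → IPC φ
  | mp {φ ψ : Formula} : IPC (imp φ ψ) → IPC φ → IPC ψ
  | subst {φ : Formula} (σ : ℕ → Formula) : (∀ n, CoimpFree (σ n)) → IPC φ → IPC (φ.subst σ)

/-- The eight axioms governing co-implication. -/
def coimpAxioms : Set Formula :=
  let p := var 0
  let q := var 1
  let r := var 2
  { imp p (or q (coimp p q)),
    imp (coimp p q) (coneg (imp p q)),
    imp (coimp (coimp p q) r) (coimp p (or q r)),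
    imp (neg (coimp p q)) (imp p q),
    imp (imp p (coimp q q)) (neg p),
    imp (neg p) (imp p (coimp q q)),
    imp (coimp (imp p p) q) (coneg q),
    imp (coneg q) (coimp (imp p p) q) }

/-- Closure under modus ponens, uniform substitution and the double negation rule. -/
structure ClosedUnderRules (L : Set Formula) : Prop where
  mp : ∀ φ ψ : Formula, imp φ ψ ∈ L → φ ∈ L → ψ ∈ L
  subst : ∀ (σ : ℕ → Formula) (φ : Formula), φ ∈ L → φ.subst σ ∈ L
  dn : ∀ φ : Formula, φ ∈ L → neg (coneg φ) ∈ L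

/-- The bi-intuitionistic propositional calculus: the least set of formulas that contains `IPC` and
the co-implication axioms, and is closed under the three rules. -/
def BiIPC : Set Formula :=
  ⋂₀ {X | {φ | IPC φ} ⊆ X ∧ coimpAxioms ⊆ X ∧ ClosedUnderRules X}

/-- Super-bi-intuitionistic logics. -/
structure IsLogic (L : Set Formula) : Prop where
  closed : ClosedUnderRules L
  biIPC_subset : BiIPC ⊆ L

/-- `L + S`: the least super-bi-intuitionistic logic that contains `L ∪ S`. -/
def plus (L S : Set Formula) : Set Formula :=
  ⋂₀ {X | IsLogic X ∧ L ∪ S ⊆ X}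

/-- The Gödel-Dummett formula `(p → q) ∨ (q → p)`. -/
def linearity : Formula := or (imp (var 0) (var 1)) (imp (var 1) (var 0))

/-- The bi-intuitionistic linear calculus. -/
def BiLC : Set Formula := plus BiIPC {linearity}

/-! ### Algebras -/

/-- `A ⊨ φ`. -/
def Valid (A : Type*) [BiheytingAlgebra A] (φ : Formula) : Prop :=
  ∀ v : ℕ → A, φ.eval v = ⊤

/-- Bi-Gödel algebras: bi-Heyting algebras that validate the Gödel-Dummett formula. -/
def IsBiGodel (A : Type*) [BiheytingAlgebra A] : Prop := Valid A linearity

/-- Congruences of a bi-Heyting algebra. -/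
structure IsCongruence {A : Type*} [BiheytingAlgebra A] (θ : Setoid A) : Prop where
  sup : ∀ {a b c d : A}, θ a b → θ c d → θ (a ⊔ c) (b ⊔ d)
  inf : ∀ {a b c d : A}, θ a b → θ c d → θ (a ⊓ c) (b ⊓ d)
  himp : ∀ {a b c d : A}, θ a b → θ c d → θ (a ⇨ c) (b ⇨ d)
  sdiff : ∀ {a b c d : A}, θ a b → θ c d → θ (a \ c) (b \ d)

/-- Subdirectly irreducible: there is a least congruence among those other than the identity
relation `⊥` (so the one-element algebra is excluded). -/
def IsSI (A : Type*) [BiheytingAlgebra A] : Prop :=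
  ∃ θ : Setoid A, IsCongruence θ ∧ θ ≠ ⊥ ∧
    ∀ η : Setoid A, IsCongruence η → η ≠ ⊥ → θ ≤ η

/-! ### Stable canonical formulas -/

section
variable (A : Type) [Fintype A]

/-- The variable `p_a`; distinct elements of `A` get distinct variables. -/
noncomputable def pvar (a : A) : Formula := var (Fintype.equivFin A a)

/-- Conjunction of the formulas `f a b`, for the pairs `(a, b)` in `D`. -/
noncomputable def conjOver (D : Finset (A × A)) (f : A → A → Formula) : Formula :=
  conj (D.toList.map fun x => f x.1 x.2)

variable [BiheytingAlgebra A]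

/-- `Γ`: it describes the Heyting algebra structure of `A` fully, and co-implication only for the
pairs in `D`. -/
noncomputable def diagram (D : Finset (A × A)) : Formula :=
  conj [
    conjOver A Finset.univ fun a b => iff (pvar A (a ⊔ b)) (or (pvar A a) (pvar A b)),
    conjOver A Finset.univ fun a b => iff (pvar A (a ⊓ b)) (and (pvar A a) (pvar A b)),
    conjOver A Finset.univ fun a b => iff (pvar A (a ⇨ b)) (imp (pvar A a) (pvar A b)),
    conjOver A D fun a b => iff (pvar A (a \ b)) (coimp (pvar A a) (pvar A b)),
    iff (pvar A ⊥) bot,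
    iff (pvar A ⊤) top]

open Classical in
/-- The stable canonical formula `γ(A, D) = ¬∼Γ → ¬ ⋀ {p_a ← p_b : a ≰ b}`. -/
noncomputable def stableCanonical (D : Finset (A × A)) : Formula :=
  imp (neg (coneg (diagram A D)))
    (neg (conjOver A (Finset.univ.filter fun x : A × A => ¬ x.1 ≤ x.2)
      fun a b => coimp (pvar A a) (pvar A b)))

end

/-- `φ` is the stable canonical formula `γ(A, D)` of a finite subdirectly irreducible bi-Gödel
algebra `A` and some `D ⊆ A × A`. -/
def IsStableCanonical (φ : Formula) : Prop :=
  ∃ (A : Type) (_ : Fintype A) (_ : BiheytingAlgebra A) (D : Finset (A × A)),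
    IsBiGodel A ∧ IsSI A ∧ φ = stableCanonical A D

end BiInt

namespace BiInt

open Formula

/-! ### Theories and their Lindenbaum algebras -/

/-! Filtration through finite Heyting reducts, over algebras whose bottom is meet-prime. Every
formula outside an extension of `bi-LC` is refuted in such an algebra validating the extension, the
Lindenbaum algebra of a maximal theory (`exists_botPrime_not_valid`). There `¬∼x = ⊥` unless `x =
⊤`, so refuting `γ(A, D)` means making `Γ` exactly true and each `p_a ← p_b` with `a ≰ b` nonzero.
That is an order-reflecting Heyting embedding of `A` that preserves co-implication on `D`
(`not_valid_stableCanonical_iff`).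

Suppose such a `B` refutes `φ`. Gödel algebras are locally finite (`exists_finite_isHeytingClosed`),
so the values in `B` of the variables and co-implications of `φ` lie in a finite Heyting subalgebra
`S`. Being finite, `S` has a co-implication of its own, which agrees with that of `B` whenever the
latter stays in `S`; let `D` record these pairs. Then `B` refutes `γ(S, D)`, and any embedding
witnessing another refutation of it transports the refutation of `φ`
(`exists_stableCanonical_of_not_valid`).

Hence the stable canonical formulas in `L` axiomatize `L`; the finite case follows because
derivations use finitely many axioms. -/

/-- Sets of formulas that contain all instances of the axioms and are closed under modus ponens and
the double negation rule, but not necessarily under substitution. -/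
structure IsTheory (T : Set Formula) : Prop where
  ipcAx : ∀ φ ∈ ipcAxioms, ∀ σ, φ.subst σ ∈ T
  coimpAx : ∀ φ ∈ coimpAxioms, ∀ σ, φ.subst σ ∈ T
  mp : ∀ {φ ψ : Formula}, imp φ ψ ∈ T → φ ∈ T → ψ ∈ T
  dn : ∀ {φ : Formula}, φ ∈ T → neg (coneg φ) ∈ T

/-- The substitution sending the first three variables to `φ`, `ψ`, `χ`. -/
def substThree (φ ψ χ : Formula) : ℕ → Formula
  | 0 => φ
  | 1 => ψ
  | _ => χ

namespace IsTheory

variable {T : Set Formula}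

theorem imp_intro (h : IsTheory T) (φ ψ : Formula) : imp φ (imp ψ φ) ∈ T :=
  h.ipcAx (imp (var 0) (imp (var 1) (var 0))) (by simp [ipcAxioms]) (substThree φ ψ ψ)

theorem imp_distrib (h : IsTheory T) (φ ψ χ : Formula) :
    imp (imp φ (imp ψ χ)) (imp (imp φ ψ) (imp φ χ)) ∈ T :=
  h.ipcAx (imp (imp (var 0) (imp (var 1) (var 2))) (imp (imp (var 0) (var 1)) (imp (var 0) (var 2))))
    (by simp [ipcAxioms]) (substThree φ ψ χ)

theorem and_left (h : IsTheory T) (φ ψ : Formula) : imp (and φ ψ) φ ∈ T :=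
  h.ipcAx (imp (and (var 0) (var 1)) (var 0)) (by simp [ipcAxioms]) (substThree φ ψ ψ)

theorem and_right (h : IsTheory T) (φ ψ : Formula) : imp (and φ ψ) ψ ∈ T :=
  h.ipcAx (imp (and (var 0) (var 1)) (var 1)) (by simp [ipcAxioms]) (substThree φ ψ ψ)

theorem and_intro (h : IsTheory T) (φ ψ : Formula) : imp φ (imp ψ (and φ ψ)) ∈ T :=
  h.ipcAx (imp (var 0) (imp (var 1) (and (var 0) (var 1)))) (by simp [ipcAxioms])
    (substThree φ ψ ψ)

theorem or_left (h : IsTheory T) (φ ψ : Formula) : imp φ (or φ ψ) ∈ T :=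
  h.ipcAx (imp (var 0) (or (var 0) (var 1))) (by simp [ipcAxioms]) (substThree φ ψ ψ)

theorem or_right (h : IsTheory T) (φ ψ : Formula) : imp ψ (or φ ψ) ∈ T :=
  h.ipcAx (imp (var 1) (or (var 0) (var 1))) (by simp [ipcAxioms]) (substThree φ ψ ψ)

theorem or_elim (h : IsTheory T) (φ ψ χ : Formula) :
    imp (imp φ χ) (imp (imp ψ χ) (imp (or φ ψ) χ)) ∈ T :=
  h.ipcAx (imp (imp (var 0) (var 2)) (imp (imp (var 1) (var 2)) (imp (or (var 0) (var 1)) (var 2))))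
    (by simp [ipcAxioms]) (substThree φ ψ χ)

theorem bot_imp (h : IsTheory T) (φ : Formula) : imp bot φ ∈ T :=
  h.ipcAx (imp bot (var 0)) (by simp [ipcAxioms]) (substThree φ φ φ)

theorem top_mem (h : IsTheory T) : top ∈ T :=
  h.ipcAx top (by simp [ipcAxioms]) var

theorem imp_of_mem (h : IsTheory T) {ψ : Formula} (φ : Formula) (hψ : ψ ∈ T) : imp φ ψ ∈ T :=
  h.mp (h.imp_intro ψ φ) hψ

theorem imp_mp (h : IsTheory T) {φ ψ χ : Formula} (h₁ : imp φ (imp ψ χ) ∈ T)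
    (h₂ : imp φ ψ ∈ T) : imp φ χ ∈ T :=
  h.mp (h.mp (h.imp_distrib φ ψ χ) h₁) h₂

theorem imp_refl (h : IsTheory T) (φ : Formula) : imp φ φ ∈ T :=
  h.imp_mp (h.imp_intro φ (imp φ φ)) (h.imp_intro φ φ)

theorem imp_trans (h : IsTheory T) {φ ψ χ : Formula} (h₁ : imp φ ψ ∈ T) (h₂ : imp ψ χ ∈ T) :
    imp φ χ ∈ T :=
  h.imp_mp (h.imp_of_mem φ h₂) h₁

theorem imp_and (h : IsTheory T) {φ ψ χ : Formula} (h₁ : imp φ ψ ∈ T) (h₂ : imp φ χ ∈ T) :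
    imp φ (and ψ χ) ∈ T :=
  h.imp_mp (h.imp_trans h₁ (h.and_intro ψ χ)) h₂

theorem or_imp (h : IsTheory T) {φ ψ χ : Formula} (h₁ : imp φ χ ∈ T) (h₂ : imp ψ χ ∈ T) :
    imp (or φ ψ) χ ∈ T :=
  h.mp (h.mp (h.or_elim φ ψ χ) h₁) h₂

theorem imp_imp_iff (h : IsTheory T) {φ ψ χ : Formula} :
    imp φ (imp ψ χ) ∈ T ↔ imp (and φ ψ) χ ∈ T := by
  refine ⟨fun h₁ => h.imp_mp (h.imp_trans (h.and_left φ ψ) h₁) (h.and_right φ ψ), fun h₁ => ?_⟩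
  refine h.imp_trans (h.and_intro φ ψ) ?_
  exact h.mp (h.imp_distrib ψ (and φ ψ) χ) (h.imp_of_mem ψ h₁)

/-- Residuation for co-implication. From right to left, the double negation rule gives `¬∼(φ → ψ ∨
χ)`, and the axioms carry this back to `¬((φ ← ψ) ← χ)`, hence to `(φ ← ψ) → χ`. -/
theorem coimp_imp_iff (h : IsTheory T) {φ ψ χ : Formula} :
    imp (coimp φ ψ) χ ∈ T ↔ imp φ (or ψ χ) ∈ T := by
  constructor
  · intro h₁
    have h₂ : imp φ (or ψ (coimp φ ψ)) ∈ T :=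
      h.coimpAx (imp (var 0) (or (var 1) (coimp (var 0) (var 1)))) (by simp [coimpAxioms])
        (substThree φ ψ χ)
    exact h.imp_trans h₂ (h.or_imp (h.or_left ψ χ) (h.imp_trans h₁ (h.or_right ψ χ)))
  · intro h₁
    have h₂ : imp (coimp φ (or ψ χ)) (coneg (imp φ (or ψ χ))) ∈ T :=
      h.coimpAx (imp (coimp (var 0) (var 1)) (coneg (imp (var 0) (var 1)))) (by simp [coimpAxioms])
        (substThree φ (or ψ χ) χ)
    have h₃ : imp (coimp (coimp φ ψ) χ) (coimp φ (or ψ χ)) ∈ T :=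
      h.coimpAx (imp (coimp (coimp (var 0) (var 1)) (var 2)) (coimp (var 0) (or (var 1) (var 2))))
        (by simp [coimpAxioms]) (substThree φ ψ χ)
    have h₄ : imp (neg (coimp (coimp φ ψ) χ)) (imp (coimp φ ψ) χ) ∈ T :=
      h.coimpAx (imp (neg (coimp (var 0) (var 1))) (imp (var 0) (var 1))) (by simp [coimpAxioms])
        (substThree (coimp φ ψ) χ χ)
    exact h.mp h₄ (h.imp_trans (h.imp_trans h₃ h₂) (h.dn h₁))

/-- Provable equivalence. -/
def setoid (h : IsTheory T) : Setoid Formula where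
  r φ ψ := imp φ ψ ∈ T ∧ imp ψ φ ∈ T
  iseqv :=
    { refl := fun φ => ⟨h.imp_refl φ, h.imp_refl φ⟩
      symm := fun hφ => ⟨hφ.2, hφ.1⟩
      trans := fun h₁ h₂ => ⟨h.imp_trans h₁.1 h₂.1, h.imp_trans h₂.2 h₁.2⟩ }

/-- The Lindenbaum algebra of a theory. -/
def Lindenbaum (h : IsTheory T) : Type := Quotient h.setoid

/-- The class of a formula in the Lindenbaum algebra. -/
def cls (h : IsTheory T) (φ : Formula) : h.Lindenbaum := Quotient.mk h.setoid φ

theorem cls_surjective (h : IsTheory T) : Function.Surjective h.cls := Quotient.exists_rep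

instance (h : IsTheory T) : LE h.Lindenbaum where
  le := Quotient.lift₂ (fun φ ψ => imp φ ψ ∈ T) fun _ _ _ _ h₁ h₂ => propext
    ⟨fun h₃ => h.imp_trans h₁.2 (h.imp_trans h₃ h₂.1),
      fun h₃ => h.imp_trans h₁.1 (h.imp_trans h₃ h₂.2)⟩

theorem cls_le_cls (h : IsTheory T) {φ ψ : Formula} : h.cls φ ≤ h.cls ψ ↔ imp φ ψ ∈ T := Iff.rfl

instance (h : IsTheory T) : PartialOrder h.Lindenbaum where
  le_refl := by rintro ⟨φ⟩; exact h.imp_refl φ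
  le_trans := by rintro ⟨φ⟩ ⟨ψ⟩ ⟨χ⟩ h₁ h₂; exact h.imp_trans h₁ h₂
  le_antisymm := by rintro ⟨φ⟩ ⟨ψ⟩ h₁ h₂; exact Quotient.sound ⟨h₁, h₂⟩

instance (h : IsTheory T) : Lattice h.Lindenbaum where
  sup := Quotient.map₂ or fun _ _ h₁ _ _ h₂ =>
    ⟨h.or_imp (h.imp_trans h₁.1 (h.or_left _ _)) (h.imp_trans h₂.1 (h.or_right _ _)),
      h.or_imp (h.imp_trans h₁.2 (h.or_left _ _)) (h.imp_trans h₂.2 (h.or_right _ _))⟩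
  inf := Quotient.map₂ and fun _ _ h₁ _ _ h₂ =>
    ⟨h.imp_and (h.imp_trans (h.and_left _ _) h₁.1) (h.imp_trans (h.and_right _ _) h₂.1),
      h.imp_and (h.imp_trans (h.and_left _ _) h₁.2) (h.imp_trans (h.and_right _ _) h₂.2)⟩
  le_sup_left := by rintro ⟨φ⟩ ⟨ψ⟩; exact h.or_left φ ψ
  le_sup_right := by rintro ⟨φ⟩ ⟨ψ⟩; exact h.or_right φ ψ
  sup_le := by rintro ⟨φ⟩ ⟨ψ⟩ ⟨χ⟩ h₁ h₂; exact h.or_imp h₁ h₂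
  inf_le_left := by rintro ⟨φ⟩ ⟨ψ⟩; exact h.and_left φ ψ
  inf_le_right := by rintro ⟨φ⟩ ⟨ψ⟩; exact h.and_right φ ψ
  le_inf := by rintro ⟨φ⟩ ⟨ψ⟩ ⟨χ⟩ h₁ h₂; exact h.imp_and h₁ h₂

theorem imp_congr (h : IsTheory T) {φ φ' ψ ψ' : Formula} (h₁ : imp φ' φ ∈ T) (h₂ : imp ψ ψ' ∈ T) :
    imp (imp φ ψ) (imp φ' ψ') ∈ T := by
  refine h.imp_imp_iff.2 (h.imp_trans ?_ h₂)
  exact h.imp_mp (h.and_left _ _) (h.imp_trans (h.and_right _ _) h₁)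

theorem coimp_congr (h : IsTheory T) {φ φ' ψ ψ' : Formula} (h₁ : imp φ φ' ∈ T)
    (h₂ : imp ψ' ψ ∈ T) : imp (coimp φ ψ) (coimp φ' ψ') ∈ T := by
  refine h.coimp_imp_iff.2 (h.imp_trans h₁ ?_)
  refine h.imp_trans (h.coimp_imp_iff.1 (h.imp_refl (coimp φ' ψ'))) ?_
  exact h.or_imp (h.imp_trans h₂ (h.or_left _ _)) (h.or_right _ _)

instance (h : IsTheory T) : BiheytingAlgebra h.Lindenbaum where
  top := h.cls top
  bot := h.cls bot
  himp := Quotient.map₂ imp fun _ _ h₁ _ _ h₂ => ⟨h.imp_congr h₁.2 h₂.1, h.imp_congr h₁.1 h₂.2⟩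
  sdiff := Quotient.map₂ Formula.coimp fun _ _ h₁ _ _ h₂ =>
    ⟨h.coimp_congr h₁.1 h₂.2, h.coimp_congr h₁.2 h₂.1⟩
  compl := Quotient.map neg fun _ _ h₁ =>
    ⟨h.imp_congr h₁.2 (h.imp_refl _), h.imp_congr h₁.1 (h.imp_refl _)⟩
  hnot := Quotient.map coneg fun _ _ h₁ =>
    ⟨h.coimp_congr (h.imp_refl _) h₁.2, h.coimp_congr (h.imp_refl _) h₁.1⟩
  le_top := by rintro ⟨φ⟩; exact h.imp_of_mem φ h.top_mem
  bot_le := by rintro ⟨φ⟩; exact h.bot_imp φ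
  le_himp_iff := by rintro ⟨φ⟩ ⟨ψ⟩ ⟨χ⟩; exact h.imp_imp_iff
  sdiff_le_iff := by rintro ⟨φ⟩ ⟨ψ⟩ ⟨χ⟩; exact h.coimp_imp_iff
  himp_bot := by rintro ⟨φ⟩; rfl
  top_sdiff := by rintro ⟨φ⟩; rfl

theorem cls_eq_top (h : IsTheory T) {φ : Formula} : h.cls φ = ⊤ ↔ φ ∈ T := by
  rw [← top_le_iff]
  exact ⟨fun h₁ => h.mp (h.cls_le_cls.1 h₁) h.top_mem, fun h₁ => h.imp_of_mem top h₁⟩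

theorem eval_cls (h : IsTheory T) (σ : ℕ → Formula) (φ : Formula) :
    φ.eval (fun n => h.cls (σ n)) = h.cls (φ.subst σ) := by
  induction φ with
  | var n => rfl
  | bot => rfl
  | top => rfl
  | and φ ψ h₁ h₂ => simp only [eval, h₁, h₂]; rfl
  | or φ ψ h₁ h₂ => simp only [eval, h₁, h₂]; rfl
  | imp φ ψ h₁ h₂ => simp only [eval, h₁, h₂]; rfl
  | coimp φ ψ h₁ h₂ => simp only [eval, h₁, h₂]; rfl

/-- Valuations in the Lindenbaum algebra are substitutions. All instances are needed because `T`
need not be closed under substitution. -/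
theorem valid_iff (h : IsTheory T) {φ : Formula} :
    Valid h.Lindenbaum φ ↔ ∀ σ, φ.subst σ ∈ T := by
  constructor
  · intro h₁ σ
    rw [← h.cls_eq_top, ← h.eval_cls]
    exact h₁ _
  · intro h₁ v
    obtain ⟨σ, rfl⟩ : ∃ σ : ℕ → Formula, v = fun n => h.cls (σ n) :=
      ⟨fun n => (h.cls_surjective (v n)).choose,
        funext fun n => ((h.cls_surjective (v n)).choose_spec).symm⟩
    rw [h.eval_cls, h.cls_eq_top]
    exact h₁ σ

end IsTheory

theorem Formula.subst_var (φ : Formula) : φ.subst var = φ := by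
  induction φ <;> simp_all [Formula.subst]

/-! ### Elementary facts about logics -/

theorem subset_biIPC_ipc {φ : Formula} (h : φ ∈ ipcAxioms) : φ ∈ BiIPC :=
  fun _ hX => hX.1 (IPC.ax h)

theorem subset_biIPC_coimp {φ : Formula} (h : φ ∈ coimpAxioms) : φ ∈ BiIPC :=
  fun _ hX => hX.2.1 h

theorem IsLogic.isTheory {L : Set Formula} (hL : IsLogic L) : IsTheory L where
  ipcAx _ h σ := hL.closed.subst σ _ (hL.biIPC_subset (subset_biIPC_ipc h))
  coimpAx _ h σ := hL.closed.subst σ _ (hL.biIPC_subset (subset_biIPC_coimp h))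
  mp := hL.closed.mp _ _
  dn := hL.closed.dn _

theorem IsTheory.of_logic_subset {L T : Set Formula} (hL : IsLogic L) (hLT : L ⊆ T)
    (mp : ∀ {φ ψ : Formula}, imp φ ψ ∈ T → φ ∈ T → ψ ∈ T)
    (dn : ∀ {φ : Formula}, φ ∈ T → neg (coneg φ) ∈ T) : IsTheory T where
  ipcAx φ h σ := hLT (hL.isTheory.ipcAx φ h σ)
  coimpAx φ h σ := hLT (hL.isTheory.coimpAx φ h σ)
  mp := mp
  dn := dn

theorem subset_plus (L S : Set Formula) : L ∪ S ⊆ plus L S := fun _ hφ _ hX => hX.2 hφ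

theorem plus_subset {L S X : Set Formula} (hX : IsLogic X) (h : L ∪ S ⊆ X) : plus L S ⊆ X :=
  fun _ hφ => hφ X ⟨hX, h⟩

theorem plus_mono (L : Set Formula) {S S' : Set Formula} (h : S ⊆ S') : plus L S ⊆ plus L S' :=
  fun _ hφ X hX => hφ X ⟨hX.1, (Set.union_subset_union_right L h).trans hX.2⟩

theorem isLogic_plus {L : Set Formula} (hL : BiIPC ⊆ L) (S : Set Formula) :
    IsLogic (plus L S) where
  closed :=
    { mp := fun φ ψ h₁ h₂ X hX => hX.1.closed.mp φ ψ (h₁ X hX) (h₂ X hX)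
      subst := fun σ φ h X hX => hX.1.closed.subst σ φ (h X hX)
      dn := fun φ h X hX => hX.1.closed.dn φ (h X hX) }
  biIPC_subset := (hL.trans Set.subset_union_left).trans (subset_plus L S)

theorem isLogic_biLC : IsLogic BiLC := isLogic_plus subset_rfl _

theorem linearity_mem_biLC : linearity ∈ BiLC :=
  subset_plus _ _ (Or.inr rfl)

/-- Every member of `L + S` belongs to `L + S'` for some finite `S' ⊆ S`. -/
theorem exists_finite_mem_plus {L S : Set Formula} (hL : BiIPC ⊆ L) {φ : Formula}
    (hφ : φ ∈ plus L S) : ∃ S' ⊆ S, S'.Finite ∧ φ ∈ plus L S' := by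
  refine plus_subset (X := {φ | ∃ S' ⊆ S, S'.Finite ∧ φ ∈ plus L S'}) ?_ ?_ hφ
  · refine ⟨⟨?_, ?_, ?_⟩, ?_⟩
    · rintro φ ψ ⟨S₁, hS₁, hf₁, h₁⟩ ⟨S₂, hS₂, hf₂, h₂⟩
      exact ⟨S₁ ∪ S₂, Set.union_subset hS₁ hS₂, hf₁.union hf₂,
        (isLogic_plus hL _).closed.mp φ ψ (plus_mono L Set.subset_union_left h₁)
          (plus_mono L Set.subset_union_right h₂)⟩
    · rintro σ φ ⟨S₁, hS₁, hf₁, h₁⟩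
      exact ⟨S₁, hS₁, hf₁, (isLogic_plus hL _).closed.subst σ φ h₁⟩
    · rintro φ ⟨S₁, hS₁, hf₁, h₁⟩
      exact ⟨S₁, hS₁, hf₁, (isLogic_plus hL _).closed.dn φ h₁⟩
    · exact fun φ h => ⟨∅, Set.empty_subset S, Set.finite_empty,
        (isLogic_plus hL ∅).biIPC_subset h⟩
  · rintro φ (h | h)
    · exact ⟨∅, Set.empty_subset S, Set.finite_empty, subset_plus L ∅ (Or.inl h)⟩
    · exact ⟨{φ}, Set.singleton_subset_iff.2 h, Set.finite_singleton φ,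
        subset_plus L {φ} (Or.inr rfl)⟩

/-- A finite subset of `L + S` is contained in `L + S'` for some finite `S' ⊆ S`. -/
theorem exists_finite_subset_plus {L S F : Set Formula} (hL : BiIPC ⊆ L) (hF : F.Finite)
    (hFS : F ⊆ plus L S) : ∃ S' ⊆ S, S'.Finite ∧ F ⊆ plus L S' := by
  have key : ∀ φ : Formula, ∃ S' ⊆ S, S'.Finite ∧ (φ ∈ F → φ ∈ plus L S') := by
    intro φ
    by_cases hφ : φ ∈ F
    · obtain ⟨S', h₁, h₂, h₃⟩ := exists_finite_mem_plus hL (hFS hφ)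
      exact ⟨S', h₁, h₂, fun _ => h₃⟩
    · exact ⟨∅, Set.empty_subset S, Set.finite_empty, fun h => absurd h hφ⟩
  choose f hf₁ hf₂ hf₃ using key
  refine ⟨⋃ φ ∈ F, f φ, Set.iUnion₂_subset fun φ _ => hf₁ φ, hF.biUnion fun φ _ => hf₂ φ, ?_⟩
  exact fun φ hφ => plus_mono L (Set.subset_biUnion_of_mem hφ) (hf₃ φ hφ)

/-! ### Local finiteness of Gödel algebras -/

/-- Prime filters of a bounded lattice, the improper one included. -/
structure IsPrimeFilter {H : Type*} [HeytingAlgebra H] (P : Set H) : Prop where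
  top_mem : ⊤ ∈ P
  mono : ∀ {a b : H}, a ≤ b → a ∈ P → b ∈ P
  inf_mem : ∀ {a b : H}, a ∈ P → b ∈ P → a ⊓ b ∈ P
  sup_mem : ∀ {a b : H}, a ⊔ b ∈ P → a ∈ P ∨ b ∈ P

/-- Subalgebras of a Heyting algebra. -/
structure IsHeytingClosed {H : Type*} [HeytingAlgebra H] (S : Set H) : Prop where
  bot_mem : ⊥ ∈ S
  top_mem : ⊤ ∈ S
  inf_mem : ∀ {a b : H}, a ∈ S → b ∈ S → a ⊓ b ∈ S
  sup_mem : ∀ {a b : H}, a ∈ S → b ∈ S → a ⊔ b ∈ S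
  himp_mem : ∀ {a b : H}, a ∈ S → b ∈ S → a ⇨ b ∈ S

section Godel

variable {H : Type*} [HeytingAlgebra H]

theorem exists_isPrimeFilter_notMem {x : H} (hx : x ≠ ⊤) :
    ∃ P : Set H, IsPrimeFilter P ∧ x ∉ P := by
  have hd : Disjoint ((Order.PFilter.principal (⊤ : H) : Order.PFilter H) : Set H)
      (Order.Ideal.principal x : Order.Ideal H) := by
    rw [Set.disjoint_left]
    intro a ha ha'
    rw [SetLike.mem_coe, Order.PFilter.mem_principal] at ha
    rw [SetLike.mem_coe, Order.Ideal.mem_principal] at ha'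
    exact hx (top_le_iff.1 (ha.trans ha'))
  obtain ⟨J, hJ, hxJ, hdJ⟩ := DistribLattice.prime_ideal_of_disjoint_filter_ideal hd
  refine ⟨(J : Set H)ᶜ, ⟨?_, ?_, ?_, ?_⟩, ?_⟩
  · exact Set.disjoint_left.1 hdJ (Order.PFilter.mem_principal.2 le_rfl)
  · exact fun hab ha hb => ha (J.lower hab hb)
  · exact fun ha hb hab => (hJ.mem_or_mem hab).elim ha hb
  · intro a b hab
    by_contra! hc
    simp only [Set.mem_compl_iff, not_not] at hc
    exact hab (Order.Ideal.sup_mem hc.1 hc.2)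
  · exact fun hx' => hx' (hxJ (Order.Ideal.mem_principal.2 le_rfl))

namespace IsPrimeFilter

variable {P : Set H}

theorem himp_of_le (hP : IsPrimeFilter P) {a b : H} (hab : a ≤ b) : a ⇨ b ∈ P := by
  rw [himp_eq_top_iff.2 hab]
  exact hP.top_mem

theorem himp_trans (hP : IsPrimeFilter P) {a b c : H} (hab : a ⇨ b ∈ P) (hbc : b ⇨ c ∈ P) :
    a ⇨ c ∈ P :=
  hP.mono (himp_triangle a b c) (hP.inf_mem hab hbc)

theorem himp_inf (hP : IsPrimeFilter P) {a b c : H} (hab : a ⇨ b ∈ P) (hac : a ⇨ c ∈ P) :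
    a ⇨ b ⊓ c ∈ P := by
  rw [himp_inf_distrib]
  exact hP.inf_mem hab hac

theorem sup_himp (hP : IsPrimeFilter P) {a b c : H} (hac : a ⇨ c ∈ P) (hbc : b ⇨ c ∈ P) :
    a ⊔ b ⇨ c ∈ P := by
  rw [sup_himp_distrib]
  exact hP.inf_mem hac hbc

theorem himp_total (hlin : ∀ a b : H, (a ⇨ b) ⊔ (b ⇨ a) = ⊤) (hP : IsPrimeFilter P) (a b : H) :
    a ⇨ b ∈ P ∨ b ⇨ a ∈ P :=
  hP.sup_mem (by rw [hlin]; exact hP.top_mem)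

/-- Modulo `P` the algebra is a chain, and in a chain `a → b` equals `b` unless `a ≤ b`. -/
theorem himp_himp_right (hlin : ∀ a b : H, (a ⇨ b) ⊔ (b ⇨ a) = ⊤) (hP : IsPrimeFilter P)
    {a b : H} (hab : a ⇨ b ∉ P) : (a ⇨ b) ⇨ b ∈ P := by
  rcases hP.himp_total hlin (a ⇨ b) a with h | h
  · refine hP.mono ?_ h
    rw [le_himp_iff]
    calc ((a ⇨ b) ⇨ a) ⊓ (a ⇨ b) ≤ a ⊓ (a ⇨ b) := le_inf himp_inf_le inf_le_right
      _ ≤ b := inf_himp_le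
  · rw [himp_himp, inf_idem] at h
    exact absurd h hab

end IsPrimeFilter

/-- The element `b` agrees modulo each prime filter with a member of `G`, which depends only on how
the filter orders `G`. -/
def IsRepresentedBy (G : Set H) (f : Set (G × G) → G) (b : H) : Prop :=
  ∀ P : Set H, IsPrimeFilter P →
    b ⇨ (f {x | (x.1 : H) ⇨ x.2 ∈ P} : H) ∈ P ∧ (f {x | (x.1 : H) ⇨ x.2 ∈ P} : H) ⇨ b ∈ P

theorem IsRepresentedBy.unique {G : Set H} {f : Set (G × G) → G} {a b : H}
    (ha : IsRepresentedBy G f a) (hb : IsRepresentedBy G f b) : a = b := by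
  have key : ∀ {a b : H}, IsRepresentedBy G f a → IsRepresentedBy G f b → a ≤ b := by
    intro a b ha hb
    rw [← himp_eq_top_iff]
    by_contra hab
    obtain ⟨P, hP, hx⟩ := exists_isPrimeFilter_notMem hab
    exact hx (hP.himp_trans (ha P hP).1 (hb P hP).2)
  exact le_antisymm (key ha hb) (key hb ha)

/-- There are finitely many maps `f`, and each represents at most one element because prime filters
separate points. -/
theorem finite_setOf_exists_isRepresentedBy {G : Set H} (hG : G.Finite) :
    {b : H | ∃ f, IsRepresentedBy G f b}.Finite := by
  have := hG.to_subtype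
  rw [Set.ofPred_exists]
  exact Set.finite_iUnion fun f => Set.Subsingleton.finite fun _ ha _ hb => ha.unique hb

-- In the chain quotient by a prime filter, each operation returns one of its arguments or `⊤`, as
-- dictated by their order. So a value in `G` can again be chosen from the order pattern alone.
open Classical in
theorem isHeytingClosed_setOf_exists_isRepresentedBy
    (hlin : ∀ a b : H, (a ⇨ b) ⊔ (b ⇨ a) = ⊤) {G : Set H} (hbot : ⊥ ∈ G) (htop : ⊤ ∈ G) :
    IsHeytingClosed {b : H | ∃ f, IsRepresentedBy G f b} where
  bot_mem := ⟨fun _ => ⟨⊥, hbot⟩, fun _ hP => ⟨hP.himp_of_le le_rfl, hP.himp_of_le le_rfl⟩⟩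
  top_mem := ⟨fun _ => ⟨⊤, htop⟩, fun _ hP => ⟨hP.himp_of_le le_rfl, hP.himp_of_le le_rfl⟩⟩
  inf_mem := by
    rintro a b ⟨f, hf⟩ ⟨g, hg⟩
    refine ⟨fun x => if (f x, g x) ∈ x then f x else g x, fun P hP => ?_⟩
    obtain ⟨hf₁, hf₂⟩ := hf P hP
    obtain ⟨hg₁, hg₂⟩ := hg P hP
    beta_reduce
    split_ifs with h
    · exact ⟨hP.himp_trans (hP.himp_of_le inf_le_left) hf₁,
        hP.himp_inf hf₂ (hP.himp_trans h hg₂)⟩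
    · have h' := (hP.himp_total hlin _ _).resolve_left h
      exact ⟨hP.himp_trans (hP.himp_of_le inf_le_right) hg₁,
        hP.himp_inf (hP.himp_trans h' hf₂) hg₂⟩
  sup_mem := by
    rintro a b ⟨f, hf⟩ ⟨g, hg⟩
    refine ⟨fun x => if (f x, g x) ∈ x then g x else f x, fun P hP => ?_⟩
    obtain ⟨hf₁, hf₂⟩ := hf P hP
    obtain ⟨hg₁, hg₂⟩ := hg P hP
    beta_reduce
    split_ifs with h
    · exact ⟨hP.sup_himp (hP.himp_trans hf₁ h) hg₁,
        hP.himp_trans hg₂ (hP.himp_of_le le_sup_right)⟩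
    · have h' := (hP.himp_total hlin _ _).resolve_left h
      exact ⟨hP.sup_himp hf₁ (hP.himp_trans hg₁ h'),
        hP.himp_trans hf₂ (hP.himp_of_le le_sup_left)⟩
  himp_mem := by
    rintro a b ⟨f, hf⟩ ⟨g, hg⟩
    refine ⟨fun x => if (f x, g x) ∈ x then ⟨⊤, htop⟩ else g x, fun P hP => ?_⟩
    obtain ⟨hf₁, hf₂⟩ := hf P hP
    obtain ⟨hg₁, hg₂⟩ := hg P hP
    beta_reduce
    split_ifs with h
    · refine ⟨hP.himp_of_le le_top, ?_⟩
      rw [top_himp]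
      exact hP.himp_trans hf₁ (hP.himp_trans h hg₂)
    · have hab : a ⇨ b ∉ P := fun hab => h (hP.himp_trans hf₂ (hP.himp_trans hab hg₁))
      exact ⟨hP.himp_trans (hP.himp_himp_right hlin hab) hg₁,
        hP.himp_trans hg₂ (hP.himp_of_le le_himp)⟩

/-- Gödel algebras are locally finite. -/
theorem exists_finite_isHeytingClosed (hlin : ∀ a b : H, (a ⇨ b) ⊔ (b ⇨ a) = ⊤) {G : Set H}
    (hG : G.Finite) : ∃ S : Set H, S.Finite ∧ IsHeytingClosed S ∧ G ⊆ S := by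
  set G' : Set H := insert ⊥ (insert ⊤ G) with hG'
  refine ⟨{b : H | ∃ f, IsRepresentedBy G' f b},
    finite_setOf_exists_isRepresentedBy ((hG.insert ⊤).insert ⊥),
    isHeytingClosed_setOf_exists_isRepresentedBy hlin (by simp [G']) (by simp [G']), ?_⟩
  exact fun b hb => ⟨fun _ => ⟨b, Or.inr (Or.inr hb)⟩,
    fun P hP => ⟨hP.himp_of_le le_rfl, hP.himp_of_le le_rfl⟩⟩

end Godel

/-! ### Bi-Heyting algebras whose bottom element is meet-prime -/

theorem isBiGodel_iff {A : Type*} [BiheytingAlgebra A] :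
    IsBiGodel A ↔ ∀ a b : A, (a ⇨ b) ⊔ (b ⇨ a) = ⊤ := by
  constructor
  · intro h a b
    exact h fun n => if n = 0 then a else b
  · exact fun h v => h (v 0) (v 1)

/-- The bottom element is meet-prime. -/
structure BotPrime (A : Type*) [BiheytingAlgebra A] : Prop where
  bot_ne_top : (⊥ : A) ≠ ⊤
  eq_bot_or_eq_bot : ∀ {a b : A}, a ⊓ b = ⊥ → a = ⊥ ∨ b = ⊥

namespace BotPrime

variable {A : Type*} [BiheytingAlgebra A]

/-- Since `∼a ⊓ ¬∼a = ⊥`, one factor is `⊥`; if it is `∼a`, then `a = ⊤`. -/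
theorem top_sdiff_himp_bot (hA : BotPrime A) {a : A} (ha : a ≠ ⊤) : (⊤ \ a) ⇨ ⊥ = ⊥ := by
  refine (hA.eq_bot_or_eq_bot (le_bot_iff.1 himp_inf_le)).resolve_right ?_
  exact fun h => ha (top_le_iff.1 (sdiff_eq_bot_iff.1 h))

/-- Such an algebra is simple, hence subdirectly irreducible. -/
theorem isSI (hA : BotPrime A) : IsSI A := by
  refine ⟨⊤, ⟨fun _ _ => trivial, fun _ _ => trivial, fun _ _ => trivial, fun _ _ => trivial⟩,
    fun h => ?_, fun η hη hne => ?_⟩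
  · have : (⊤ : Setoid A) ⊥ ⊤ := trivial
    rw [h] at this
    exact hA.bot_ne_top this
  · have key : ∀ a b : A, η a b → ¬ a ≤ b → ⊤ ≤ η := by
      intro a b hab hle
      have h₁ : η (a ⇨ b) ⊤ := by
        have := hη.himp hab (η.refl b)
        rwa [himp_self] at this
      have h₂ : η (⊤ \ (a ⇨ b)) ⊥ := by
        have := hη.sdiff (η.refl ⊤) h₁
        rwa [sdiff_self] at this
      have h₃ : η ⊥ ⊤ := by
        have := hη.himp h₂ (η.refl ⊥)
        rwa [hA.top_sdiff_himp_bot (fun h => hle (himp_eq_top_iff.1 h)), himp_self] at this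
      intro c d _
      have hc : ∀ c : A, η ⊥ c := fun c => by
        have := hη.inf (η.refl c) h₃
        rwa [inf_bot_eq, inf_top_eq] at this
      exact η.trans (η.symm (hc c)) (hc d)
    by_contra hcon
    refine hne (le_bot_iff.1 fun a b hab => ?_)
    refine le_antisymm ?_ ?_
    · by_contra h
      exact hcon (key a b hab h)
    · by_contra h
      exact hcon (key b a (η.symm hab) h)

end BotPrime

/-! ### Finite subalgebras -/

section Subalgebra

variable {B : Type*} [BiheytingAlgebra B] {S : Set B}

open Classical in
/-- The co-implication of a finite Heyting subalgebra. -/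
noncomputable def finiteSdiff (hf : S.Finite) (a b : B) : B :=
  (hf.toFinset.filter fun c => a ≤ b ⊔ c).inf id

theorem finiteSdiff_mem (hS : IsHeytingClosed S) (hf : S.Finite) (a b : B) :
    finiteSdiff hf a b ∈ S :=
  Finset.inf_induction hS.top_mem (fun _ h₁ _ h₂ => hS.inf_mem h₁ h₂) (by simp +contextual)

/-- Finite meets distribute over `b ⊔ ·`, so the meet of all admissible `c` is itself admissible. -/
theorem finiteSdiff_le_iff (hf : S.Finite) {a b c : B} (hc : c ∈ S) :
    finiteSdiff hf a b ≤ c ↔ a ≤ b ⊔ c := by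
  constructor
  · intro h
    refine le_trans ?_ (sup_le_sup_left h b)
    rw [finiteSdiff, Finset.inf_sup_distrib_left]
    exact Finset.le_inf (by simp)
  · intro h
    exact Finset.inf_le (f := id) (by simp [hc, h])

/-- The bi-Heyting algebra structure of a finite Heyting subalgebra; its co-implication may differ
from that of the ambient algebra. -/
@[reducible] noncomputable def IsHeytingClosed.biheytingAlgebra (hS : IsHeytingClosed S)
    (hf : S.Finite) : BiheytingAlgebra S where
  sup a b := ⟨a ⊔ b, hS.sup_mem a.2 b.2⟩
  inf a b := ⟨a ⊓ b, hS.inf_mem a.2 b.2⟩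
  himp a b := ⟨a ⇨ b, hS.himp_mem a.2 b.2⟩
  sdiff a b := ⟨finiteSdiff hf a b, finiteSdiff_mem hS hf a b⟩
  compl a := ⟨a ⇨ ⊥, hS.himp_mem a.2 hS.bot_mem⟩
  hnot a := ⟨finiteSdiff hf ⊤ a, finiteSdiff_mem hS hf ⊤ a⟩
  bot := ⟨⊥, hS.bot_mem⟩
  top := ⟨⊤, hS.top_mem⟩
  le_sup_left _ _ := le_sup_left (α := B)
  le_sup_right _ _ := le_sup_right (α := B)
  sup_le _ _ _ := sup_le (α := B)
  inf_le_left _ _ := inf_le_left (α := B)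
  inf_le_right _ _ := inf_le_right (α := B)
  le_inf _ _ _ := le_inf (α := B)
  le_top _ := le_top (α := B)
  bot_le _ := bot_le (α := B)
  le_himp_iff _ _ _ := le_himp_iff (α := B)
  himp_bot _ := rfl
  sdiff_le_iff _ _ c := finiteSdiff_le_iff hf c.2
  top_sdiff _ := rfl

theorem finiteSdiff_eq (hS : IsHeytingClosed S) (hf : S.Finite) {a b : B} (hab : a \ b ∈ S) :
    finiteSdiff hf a b = a \ b := by
  refine le_antisymm ?_ ?_
  · rw [finiteSdiff_le_iff hf hab]
    exact sdiff_le_iff.1 le_rfl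
  · rw [sdiff_le_iff, ← finiteSdiff_le_iff hf (finiteSdiff_mem hS hf a b)]

end Subalgebra

/-! ### Completeness -/

section Complement

variable {A : Type*} [BiheytingAlgebra A]

theorem himp_bot_sup_himp_himp_bot (hA : IsBiGodel A) (a : A) :
    (a ⇨ ⊥) ⊔ ((a ⇨ ⊥) ⇨ ⊥) = ⊤ := by
  rw [← top_le_iff, ← isBiGodel_iff.1 hA a (a ⇨ ⊥)]
  refine sup_le_sup ?_ ?_
  · rw [himp_himp, inf_idem]
  · rw [le_himp_iff]
    calc ((a ⇨ ⊥) ⇨ a) ⊓ (a ⇨ ⊥) ≤ a ⊓ (a ⇨ ⊥) := le_inf himp_inf_le inf_le_right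
      _ ≤ ⊥ := inf_himp_le

/-- By weak excluded middle `¬a` is complemented, so the principal filter it generates is closed
under `¬∼`. -/
theorem himp_bot_le_top_sdiff_himp_bot (hA : IsBiGodel A) {a x : A} (h : a ⇨ ⊥ ≤ x) :
    a ⇨ ⊥ ≤ (⊤ \ x) ⇨ ⊥ := by
  have h₁ : ⊤ \ x ≤ (a ⇨ ⊥) ⇨ ⊥ := by
    rw [sdiff_le_iff, ← himp_bot_sup_himp_himp_bot hA a]
    exact sup_le_sup_right h _
  rw [le_himp_iff, inf_comm, ← le_himp_iff]
  exact h₁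

end Complement

theorem exists_maximal_isTheory {L : Set Formula} (hL : IsLogic L) {φ : Formula} (hφ : φ ∉ L) :
    ∃ T, Maximal (fun T => L ⊆ T ∧ IsTheory T ∧ φ ∉ T) T := by
  have h := zorn_subset_nonempty {T | L ⊆ T ∧ IsTheory T ∧ φ ∉ T} ?_ L
    ⟨subset_rfl, hL.isTheory, hφ⟩
  · obtain ⟨T, -, hT⟩ := h
    exact ⟨T, hT⟩
  · intro c hc hchain hne
    obtain ⟨T₀, hT₀⟩ := hne
    have hLc : L ⊆ ⋃₀ c := (hc hT₀).1.trans (Set.subset_sUnion_of_mem hT₀)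
    refine ⟨⋃₀ c, ⟨hLc, IsTheory.of_logic_subset hL hLc ?_ ?_, ?_⟩,
      fun _ => Set.subset_sUnion_of_mem⟩
    · rintro ψ χ ⟨T₁, hT₁, h₁⟩ ⟨T₂, hT₂, h₂⟩
      rcases hchain.total hT₁ hT₂ with h | h
      · exact ⟨T₂, hT₂, (hc hT₂).2.1.mp (h h₁) h₂⟩
      · exact ⟨T₁, hT₁, (hc hT₁).2.1.mp h₁ (h h₂)⟩
    · rintro ψ ⟨T₁, hT₁, h₁⟩
      exact ⟨T₁, hT₁, (hc hT₁).2.1.dn h₁⟩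
    · rintro ⟨T₁, hT₁, h₁⟩
      exact (hc hT₁).2.2 h₁

/-- Extensions of `bi-LC` are complete for their bi-Gödel algebras with meet-prime bottom. -/
theorem exists_botPrime_not_valid {L : Set Formula} (hL : IsLogic L) (hext : BiLC ⊆ L)
    {φ : Formula} (hφ : φ ∉ L) :
    ∃ (B : Type) (_ : BiheytingAlgebra B), IsBiGodel B ∧ BotPrime B ∧ (∀ ψ ∈ L, Valid B ψ) ∧
      ¬ Valid B φ := by
  obtain ⟨T, ⟨hLT, hT, hφT⟩, hmax⟩ := exists_maximal_isTheory hL hφ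
  have hval : ∀ ψ ∈ L, Valid hT.Lindenbaum ψ := fun ψ hψ =>
    hT.valid_iff.2 fun σ => hLT (hL.closed.subst σ ψ hψ)
  have hG : IsBiGodel hT.Lindenbaum := hval _ (hext linearity_mem_biLC)
  have hne : hT.cls φ ≠ ⊤ := fun h => hφT (hT.cls_eq_top.1 h)
  -- Otherwise the filter above `¬a` gives a theory extending `T` and omitting `φ`; maximality puts
  -- `¬a` in `T`, so `a = ⊥`.
  have key : ∀ a : hT.Lindenbaum, a ≠ ⊥ → a ⇨ ⊥ ≤ hT.cls φ := by
    intro a ha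
    by_contra hle
    have hsub : T ⊆ {χ | a ⇨ ⊥ ≤ hT.cls χ} := fun χ hχ => by
      rw [Set.mem_ofPred_eq, hT.cls_eq_top.2 hχ]
      exact le_top
    have hT' : IsTheory {χ | a ⇨ ⊥ ≤ hT.cls χ} := by
      refine IsTheory.of_logic_subset hL (hLT.trans hsub) ?_ ?_
      · intro χ₁ χ₂ h₁ h₂
        have h₁ : a ⇨ ⊥ ≤ hT.cls χ₁ ⇨ hT.cls χ₂ := h₁
        exact (le_inf h₁ h₂).trans himp_inf_le
      · exact fun h => himp_bot_le_top_sdiff_himp_bot hG h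
    obtain ⟨ψ, rfl⟩ := hT.cls_surjective a
    have hψ : neg ψ ∈ T :=
      hmax ⟨hLT.trans hsub, hT', hle⟩ hsub (le_refl (hT.cls ψ ⇨ ⊥))
    have hψ' : hT.cls ψ ⇨ ⊥ = ⊤ := hT.cls_eq_top.2 hψ
    exact ha (le_bot_iff.1 (himp_eq_top_iff.1 hψ'))
  refine ⟨hT.Lindenbaum, inferInstance, hG, ⟨fun h => ?_, fun {a b} hab => ?_⟩, hval, fun h => ?_⟩
  · exact hne (top_le_iff.1 (h ▸ bot_le))
  · by_contra! hc
    -- For disjoint nonzero `a` and `b`, both `a ⇨ b` and `b ⇨ a` lie below the class of `φ`, so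
    -- linearity would make that class `⊤`.
    have aux : ∀ {a b : hT.Lindenbaum}, a ⊓ b = ⊥ → a ≠ ⊥ → a ⇨ b ≤ hT.cls φ := by
      intro a b hab ha
      refine le_trans ?_ (key a ha)
      rw [le_himp_iff, ← hab]
      exact le_inf inf_le_right himp_inf_le
    refine hne (top_le_iff.1 ?_)
    rw [← isBiGodel_iff.1 hG a b]
    exact sup_le (aux hab hc.1) (aux (inf_comm a b ▸ hab) hc.2)
  · have := hT.valid_iff.1 h var
    rw [subst_var] at this
    exact hφT this

/-! ### Semantics of stable canonical formulas -/

section Eval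

variable {C : Type*} [BiheytingAlgebra C] (v : ℕ → C)

theorem eval_conj_eq_top (l : List Formula) :
    (conj l).eval v = ⊤ ↔ ∀ φ ∈ l, φ.eval v = ⊤ := by
  induction l with
  | nil => simp [conj, eval]
  | cons φ l ih =>
    have : (conj (φ :: l)).eval v = φ.eval v ⊓ (conj l).eval v := rfl
    rw [this, inf_eq_top_iff, ih, List.forall_mem_cons]

theorem eval_conj_ne_bot (hC : BotPrime C) (l : List Formula) :
    (conj l).eval v ≠ ⊥ ↔ ∀ φ ∈ l, φ.eval v ≠ ⊥ := by
  induction l with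
  | nil => simpa [conj, eval] using hC.bot_ne_top.symm
  | cons φ l ih =>
    have : (conj (φ :: l)).eval v = φ.eval v ⊓ (conj l).eval v := rfl
    rw [this, List.forall_mem_cons, ← ih]
    constructor
    · exact fun h => ⟨fun h₁ => h (by rw [h₁, bot_inf_eq]), fun h₁ => h (by rw [h₁, inf_bot_eq])⟩
    · exact fun h h₁ => (hC.eq_bot_or_eq_bot h₁).elim h.1 h.2

theorem eval_iff_eq_top (φ ψ : Formula) :
    (Formula.iff φ ψ).eval v = ⊤ ↔ φ.eval v = ψ.eval v := by
  have : (Formula.iff φ ψ).eval v = (φ.eval v ⇨ ψ.eval v) ⊓ (ψ.eval v ⇨ φ.eval v) := rfl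
  rw [this, inf_eq_top_iff, himp_eq_top_iff, himp_eq_top_iff, le_antisymm_iff]

theorem eval_conjOver_eq_top {A : Type} [Fintype A] (D : Finset (A × A))
    (f : A → A → Formula) :
    (conjOver A D f).eval v = ⊤ ↔ ∀ a b, (a, b) ∈ D → (f a b).eval v = ⊤ := by
  simp only [conjOver, eval_conj_eq_top, List.forall_mem_map, Finset.mem_toList, Prod.forall]

theorem eval_conjOver_ne_bot (hC : BotPrime C) {A : Type} [Fintype A] (D : Finset (A × A))
    (f : A → A → Formula) :
    (conjOver A D f).eval v ≠ ⊥ ↔ ∀ a b, (a, b) ∈ D → (f a b).eval v ≠ ⊥ := by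
  simp only [conjOver, eval_conj_ne_bot v hC, List.forall_mem_map, Finset.mem_toList, Prod.forall]

end Eval

/-- Embeddings of Heyting algebras that preserve the co-implications of the pairs in `D`. -/
structure IsStableEmbedding {A C : Type*} [BiheytingAlgebra A] [BiheytingAlgebra C]
    (D : Finset (A × A)) (e : A → C) : Prop where
  sup : ∀ a b, e (a ⊔ b) = e a ⊔ e b
  inf : ∀ a b, e (a ⊓ b) = e a ⊓ e b
  himp : ∀ a b, e (a ⇨ b) = e a ⇨ e b
  sdiff : ∀ a b, (a, b) ∈ D → e (a \ b) = e a \ e b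
  bot : e ⊥ = ⊥
  top : e ⊤ = ⊤
  le_of_le : ∀ a b, e a ≤ e b → a ≤ b

theorem eval_stableCanonical_ne_top {A : Type} [Fintype A] [BiheytingAlgebra A]
    (D : Finset (A × A)) {C : Type*} [BiheytingAlgebra C] (hC : BotPrime C) (v : ℕ → C) :
    (stableCanonical A D).eval v ≠ ⊤ ↔
      IsStableEmbedding D fun a => v (Fintype.equivFin A a) := by
  classical
  have h₁ : (stableCanonical A D).eval v ≠ ⊤ ↔ (diagram A D).eval v = ⊤ ∧
      (conjOver A (Finset.univ.filter fun x : A × A => ¬ x.1 ≤ x.2)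
        fun a b => coimp (pvar A a) (pvar A b)).eval v ≠ ⊥ := by
    set Γ := diagram A D with hΓ
    unfold stableCanonical
    rw [← hΓ]
    set Δ := conjOver A (Finset.univ.filter fun x : A × A => ¬ x.1 ≤ x.2)
      fun a b => coimp (pvar A a) (pvar A b) with hΔ
    have : (imp (neg (coneg Γ)) (neg Δ)).eval v =
        ((⊤ \ Γ.eval v) ⇨ ⊥) ⇨ (Δ.eval v ⇨ ⊥) := rfl
    have : (imp (neg (coneg Γ)) (neg Δ)).eval v = ⊤ ↔
        ((⊤ \ Γ.eval v) ⇨ ⊥) ⊓ Δ.eval v = ⊥ := by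
      rw [this, himp_eq_top_iff, le_himp_iff, le_bot_iff]
    rw [Ne, Ne]
    refine Iff.trans (Iff.not (by convert this)) ?_
    constructor
    · refine fun h => ⟨?_, fun h₂ => h (by rw [h₂, inf_bot_eq])⟩
      by_contra h₂
      exact h (by rw [hC.top_sdiff_himp_bot h₂, bot_inf_eq])
    · rintro ⟨h₂, h₃⟩ h₄
      rw [h₂, sdiff_self, himp_self, top_inf_eq] at h₄
      exact h₃ h₄
  have hp : ∀ a : A, (pvar A a).eval v = v (Fintype.equivFin A a) := fun _ => rfl
  rw [h₁, eval_conjOver_ne_bot v hC, diagram, eval_conj_eq_top]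
  simp only [List.forall_mem_cons, eval_conjOver_eq_top, eval_iff_eq_top, eval, hp,
    Finset.mem_univ, Finset.mem_filter, forall_true_left, true_and, ne_eq, sdiff_eq_bot_iff,
    List.not_mem_nil, false_imp_iff, implies_true, and_true]
  constructor
  · rintro ⟨⟨hs, hi, hh, hd, hb, ht⟩, hl⟩
    exact ⟨hs, hi, hh, hd, hb, ht, fun a b => not_imp_not.1 (hl a b)⟩
  · rintro ⟨hs, hi, hh, hd, hb, ht, hl⟩
    exact ⟨⟨hs, hi, hh, hd, hb, ht⟩, fun a b => not_imp_not.2 (hl a b)⟩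

/-- An algebra with meet-prime bottom refutes `γ(A, D)` iff `A` embeds into it. -/
theorem not_valid_stableCanonical_iff {A : Type} [Fintype A] [BiheytingAlgebra A]
    (D : Finset (A × A)) {C : Type*} [BiheytingAlgebra C] (hC : BotPrime C) :
    ¬ Valid C (stableCanonical A D) ↔ ∃ e : A → C, IsStableEmbedding D e := by
  rw [Valid, not_forall]
  constructor
  · rintro ⟨v, hv⟩
    exact ⟨_, (eval_stableCanonical_ne_top D hC v).1 hv⟩
  · rintro ⟨e, he⟩
    have hinj : Function.Injective fun a => (Fintype.equivFin A a : ℕ) :=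
      Fin.val_injective.comp (Fintype.equivFin A).injective
    -- Variables not of the form `p_a` do not matter and get the value `⊥`.
    refine ⟨Function.extend (fun a => (Fintype.equivFin A a : ℕ)) e ⊥,
      (eval_stableCanonical_ne_top D hC _).2 ?_⟩
    convert he using 2 with a
    exact hinj.extend_apply e ⊥ a

/-! ### Filtration -/

section Filtration

variable {B : Type*} [BiheytingAlgebra B]

/-- The values of the variables and of the co-implications that occur in a formula. -/
def subvalues (v : ℕ → B) : Formula → Set B
  | var n => {v n}
  | Formula.bot => ∅
  | Formula.top => ∅
  | Formula.and φ ψ => subvalues v φ ∪ subvalues v ψ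
  | Formula.or φ ψ => subvalues v φ ∪ subvalues v ψ
  | imp φ ψ => subvalues v φ ∪ subvalues v ψ
  | coimp φ ψ => insert (φ.eval v \ ψ.eval v) (subvalues v φ ∪ subvalues v ψ)

theorem finite_subvalues (v : ℕ → B) (φ : Formula) : (subvalues v φ).Finite := by
  induction φ with
  | var n => exact Set.finite_singleton _
  | bot => exact Set.finite_empty
  | top => exact Set.finite_empty
  | and φ ψ h₁ h₂ => exact h₁.union h₂
  | or φ ψ h₁ h₂ => exact h₁.union h₂
  | imp φ ψ h₁ h₂ => exact h₁.union h₂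
  | coimp φ ψ h₁ h₂ => exact (h₁.union h₂).insert _

theorem eval_mem {S : Set B} (hS : IsHeytingClosed S) (v : ℕ → B) {φ : Formula}
    (h : subvalues v φ ⊆ S) : φ.eval v ∈ S := by
  induction φ with
  | var n => exact h rfl
  | bot => exact hS.bot_mem
  | top => exact hS.top_mem
  | and φ ψ h₁ h₂ =>
    exact hS.inf_mem (h₁ (Set.union_subset_iff.1 h).1) (h₂ (Set.union_subset_iff.1 h).2)
  | or φ ψ h₁ h₂ =>
    exact hS.sup_mem (h₁ (Set.union_subset_iff.1 h).1) (h₂ (Set.union_subset_iff.1 h).2)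
  | imp φ ψ h₁ h₂ =>
    exact hS.himp_mem (h₁ (Set.union_subset_iff.1 h).1) (h₂ (Set.union_subset_iff.1 h).2)
  | coimp φ ψ h₁ h₂ => exact h (Set.mem_insert _ _)

open Classical in
/-- A stable embedding of a finite Heyting subalgebra `S` commutes with the evaluation of the
formulas whose subvalues lie in `S`, provided it preserves the relevant co-implications. -/
theorem eval_comp_stableEmbedding {S : Set B} (hS : IsHeytingClosed S) (hf : S.Finite)
    {C : Type*} [BiheytingAlgebra C] {D : Finset (S × S)}
    (hD : ∀ a b : S, (a \ b : B) ∈ S → (a, b) ∈ D) {e : S → C}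
    (he : @IsStableEmbedding S C (hS.biheytingAlgebra hf) _ D e) (v : ℕ → B) {φ : Formula}
    (h : subvalues v φ ⊆ S) :
    φ.eval (fun n => if hn : v n ∈ S then e ⟨v n, hn⟩ else ⊥) = e ⟨φ.eval v, eval_mem hS v h⟩ := by
  let _ := hS.biheytingAlgebra hf
  induction φ with
  | var n =>
    have hn : v n ∈ S := h rfl
    simp only [eval, hn, dif_pos]
  | bot => exact he.bot.symm
  | top => exact he.top.symm
  | and φ ψ h₁ h₂ =>
    have h' := Set.union_subset_iff.1 h
    simp only [eval, h₁ h'.1, h₂ h'.2]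
    exact (he.inf _ _).symm
  | or φ ψ h₁ h₂ =>
    have h' := Set.union_subset_iff.1 h
    simp only [eval, h₁ h'.1, h₂ h'.2]
    exact (he.sup _ _).symm
  | imp φ ψ h₁ h₂ =>
    have h' := Set.union_subset_iff.1 h
    simp only [eval, h₁ h'.1, h₂ h'.2]
    exact (he.himp _ _).symm
  | coimp φ ψ h₁ h₂ =>
    have h' := Set.union_subset_iff.1 ((Set.subset_insert _ _).trans h)
    have hmem : φ.eval v \ ψ.eval v ∈ S := h (Set.mem_insert _ _)
    simp only [eval, h₁ h'.1, h₂ h'.2]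
    rw [← he.sdiff _ _ (hD ⟨_, eval_mem hS v h'.1⟩ ⟨_, eval_mem hS v h'.2⟩ hmem)]
    exact congrArg e (Subtype.ext (finiteSdiff_eq hS hf hmem))

end Filtration

/-- If a bi-Gödel algebra `B` with meet-prime bottom refutes `φ`, then it refutes a stable canonical
formula all of whose refuting algebras (with meet-prime bottom) refute `φ`. -/
theorem exists_stableCanonical_of_not_valid {B : Type} [BiheytingAlgebra B] (hG : IsBiGodel B)
    (hB : BotPrime B) {φ : Formula} (hφ : ¬ Valid B φ) :
    ∃ γ, IsStableCanonical γ ∧ ¬ Valid B γ ∧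
      ∀ (C : Type) [BiheytingAlgebra C], BotPrime C → ¬ Valid C γ → ¬ Valid C φ := by
  classical
  rw [Valid, not_forall] at hφ
  obtain ⟨v, hv⟩ := hφ
  obtain ⟨S, hf, hS, hsub⟩ :=
    exists_finite_isHeytingClosed (isBiGodel_iff.1 hG) (finite_subvalues v φ)
  let _ := hS.biheytingAlgebra hf
  let _ := hf.fintype
  have hA : BotPrime S := by
    refine ⟨fun h => hB.bot_ne_top (congrArg Subtype.val h), fun {a b} hab => ?_⟩
    refine (hB.eq_bot_or_eq_bot (congrArg Subtype.val hab : (a ⊓ b : B) = ⊥)).imp ?_ ?_ <;>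
      exact fun h => Subtype.ext h
  have hAG : IsBiGodel S :=
    isBiGodel_iff.2 fun a b => Subtype.ext (isBiGodel_iff.1 hG (a : B) b)
  -- `D` consists of the pairs whose co-implication in `B` stays in `S`; on these the inclusion
  -- preserves it.
  let D : Finset (S × S) := Finset.univ.filter fun x => (x.1 \ x.2 : B) ∈ S
  refine ⟨stableCanonical S D, ⟨S, inferInstance, inferInstance, D, hAG, hA.isSI, rfl⟩, ?_, ?_⟩
  · refine (not_valid_stableCanonical_iff D hB).2 ⟨Subtype.val, ?_⟩
    exact
      { sup := fun _ _ => rfl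
        inf := fun _ _ => rfl
        himp := fun _ _ => rfl
        sdiff := fun a b hab => finiteSdiff_eq hS hf (Finset.mem_filter.1 hab).2
        bot := rfl
        top := rfl
        le_of_le := fun _ _ h => h }
  · intro C _ hC hγ hval
    obtain ⟨e, he⟩ := (not_valid_stableCanonical_iff D hC).1 hγ
    have h₁ := eval_comp_stableEmbedding hS hf (D := D)
      (fun a b hab => Finset.mem_filter.2 ⟨Finset.mem_univ _, hab⟩) he v hsub
    rw [hval _, ← he.top] at h₁
    have h₂ : (⊤ : S) ≤ ⟨φ.eval v, eval_mem hS v hsub⟩ := he.le_of_le _ _ h₁.le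
    exact hv (top_le_iff.1 h₂)

/-- Extensions of `bi-LC` are axiomatized by the stable canonical formulas that they contain. -/
theorem eq_plus_stableCanonical {L : Set Formula} (hL : IsLogic L) (hext : BiLC ⊆ L) :
    L = plus BiLC {γ | γ ∈ L ∧ IsStableCanonical γ} := by
  set L' := plus BiLC {γ | γ ∈ L ∧ IsStableCanonical γ} with hL'
  have hlog : IsLogic L' := isLogic_plus isLogic_biLC.biIPC_subset _
  have hsub : BiLC ⊆ L' := Set.subset_union_left.trans (subset_plus _ _)
  refine Set.Subset.antisymm (fun φ hφ => ?_)
    (plus_subset hL (Set.union_subset hext fun γ hγ => hγ.1))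
  by_contra hφ'
  obtain ⟨B, _, hG, hB, hval, hnot⟩ := exists_botPrime_not_valid hlog hsub hφ'
  obtain ⟨γ, hγ, hBγ, hC⟩ := exists_stableCanonical_of_not_valid hG hB hnot
  refine hBγ (hval γ (subset_plus _ _ (Or.inr ⟨?_, hγ⟩)))
  -- If `γ ∉ L`, some algebra validating `L` refutes `γ`, hence refutes `φ ∈ L`.
  by_contra hγL
  obtain ⟨C, _, _, hCb, hvalC, hnotC⟩ := exists_botPrime_not_valid hL hext hγL
  exact hC C hCb hnotC (hvalC φ hφ)

end BiInt

theorem mainTheorem4 (L : Set BiInt.Formula) (hL : BiInt.IsLogic L) (hext : BiInt.BiLC ⊆ L) :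
    (∃ S : Set BiInt.Formula, (∀ φ ∈ S, BiInt.IsStableCanonical φ) ∧
      L = BiInt.plus BiInt.BiLC S) ∧
    ((∃ F : Set BiInt.Formula, F.Finite ∧ L = BiInt.plus BiInt.BiLC F) →
      ∃ S : Set BiInt.Formula, S.Finite ∧ (∀ φ ∈ S, BiInt.IsStableCanonical φ) ∧
        L = BiInt.plus BiInt.BiLC S) := by
  refine ⟨⟨_, fun _ hγ => hγ.2, BiInt.eq_plus_stableCanonical hL hext⟩, ?_⟩
  rintro ⟨F, hF, hLF⟩
  have hFL : F ⊆ L := by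
    rw [hLF]
    exact Set.subset_union_right.trans (BiInt.subset_plus _ _)
  have hbi := BiInt.isLogic_biLC.biIPC_subset
  -- Compactness: finitely many of the stable canonical formulas in `L` already derive all of `F`.
  obtain ⟨S, hS, hSf, hFS⟩ := BiInt.exists_finite_subset_plus hbi hF
    (hFL.trans (BiInt.eq_plus_stableCanonical hL hext).subset)
  refine ⟨S, hSf, fun γ hγ => (hS hγ).2, Set.Subset.antisymm ?_ ?_⟩
  · rw [hLF]
    exact BiInt.plus_subset (BiInt.isLogic_plus hbi S)
      (Set.union_subset (Set.subset_union_left.trans (BiInt.subset_plus _ _)) hFS)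
  · exact BiInt.plus_subset hL (Set.union_subset hext fun γ hγ => (hS hγ).1)
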